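/- Let $r\ge 2$ be an integer and let $\Lambda_r$ be the set of compositions of $r$, i.e. of finite sequences $\mathbf m=(m_1,\dots,m_k)$ of positive integers with $m_1+\dots+m_k=r$. For $\mathbf m=(m_1,\dots,m_k)\in\Lambda_r$ and $|z|<1$ set $$L_{\mathbf m}(z)=\sum_{0<n_1<\dots<n_k}\frac{z^{n_k}}{n_1^{m_1}\cdots n_k^{m_k}};$$ the series converges absolutely for $|z|<1$, and at the points $\rho^{\pm1}$, where $\rho=e^{i\pi/3}$, $L_{\mathbf m}(\rho^{\pm1})$ denotes the value of the continuous extension of $L_{\mathbf m}$, i.e. the limit (which exists) of $L_{\mathbf m}(z)$ as $z\to\rho^{\pm1}$ with $|z|<1$. Define integers $b(\mathbf m)$ and $b^{+}(\mathbf m)=b^{-}(\mathbf m)$, both written $b^{\pm}(\mathbf m)$, as follows. (i) If $\mathbf m=(1,1,\dots,1)$ ($r$ entries), then $b(\mathbf m)=r$ and $b^{\pm}(\mathbf m)=(-1)^{r+1}(r+1)$. (ii) If $\mathbf m=(1,\dots,1,2)$ ($r-2$ entries equal to $1$ followed by one $2$), then $b(\mathbf m)=r$ and $b^{\pm}(\mathbf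 m)=(-1)^{r}(r-2)$. (iii) Otherwise, let $j$ be the index with $m_1=\dots=m_{j-1}=1$ and $m_j\ge2$; then $b(\mathbf m)=j$ and $b^{\pm}(\mathbf m)=(-1)^{k+1}j$. Then $$\zeta(r)=\sum_{\mathbf m\in\Lambda_r} b(\mathbf m)\,L_{\mathbf m}(1/2),\qquad \zeta(r)=\sum_{\mathbf m\in\Lambda_r} b^{+}(\mathbf m)\,L_{\mathbf m}(\rho),\qquad \zeta(r)=\sum_{\mathbf m\in\Lambda_r} b^{-}(\mathbf m)\,L_{\mathbf m}(\rho^{-1}).$$ -/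

import Mathlib

namespace Polyzeta

/-- The summation range of a `k`-fold polylogarithm: tuples `0 < n₁ < ⋯ < n_k` of integers. -/
abbrev Chain (k : ℕ) : Type := {n : Fin k → ℕ // StrictMono n ∧ ∀ i, 0 < n i}

/-- The largest (that is, last) entry `n_k` of a chain, with value `0` for the empty chain. -/
def Chain.last {k : ℕ} (n : Chain k) : ℕ :=
  if h : 0 < k then n.1 ⟨k - 1, Nat.sub_lt h one_pos⟩ else 0

/-- The term `n₁ ^ (-m₁) ⋯ n_k ^ (-m_k) z ^ n_k` of the polylogarithm series. -/
noncomputable def polylogTerm {k : ℕ} (m : Fin k → ℕ) (z : ℂ) (n : Chain k) : ℂ :=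
  (∏ i, ((n.1 i : ℂ) ^ m i)⁻¹) * z ^ n.last

/-- The polylogarithm series `∑_{0 < n₁ < ⋯ < n_k} n₁ ^ (-m₁) ⋯ n_k ^ (-m_k) z ^ n_k`. -/
noncomputable def polylogSeries {k : ℕ} (m : Fin k → ℕ) (z : ℂ) : ℂ :=
  ∑' n : Chain k, polylogTerm m z n

open Classical in
/-- The polylogarithm `L_m`: the sum of the series on the open unit disc `D`, extended to the
boundary of `D` by continuity, i.e. by the limit of the sum as the point is approached
from within `D`. -/
noncomputable def polylog {k : ℕ} (m : Fin k → ℕ) (z : ℂ) : ℂ :=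
  if ‖z‖ < 1 then polylogSeries m z
  else extendFrom (Metric.ball (0 : ℂ) 1) (polylogSeries m) z

/-- `ρ = exp (iπ/3)`. -/
noncomputable def rho : ℂ := Complex.exp (Complex.I * Real.pi / 3)

/-- For a composition `m` with some part `≥ 2`, the index `j` (counted from `1`) with
`m₁ = ⋯ = m_{j-1} = 1` and `m_j ≥ 2`; for `m = (1, …, 1)` the number `r`. -/
def jIndex {r : ℕ} (m : Composition r) : ℕ :=
  if m.blocks = List.replicate r 1 then r
  else m.blocks.findIdx (fun t => decide (2 ≤ t)) + 1

/-- The coefficients `b(m)`; the special cases are `m = (1, …, 1)` and `m = (1, …, 1, 2)`. -/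
def bCoeff {r : ℕ} (m : Composition r) : ℤ :=
  if m.blocks = List.replicate r 1 then r
  else if m.blocks = List.replicate (r - 2) 1 ++ [2] then r
  else jIndex m

/-- The coefficients `b⁺(m) = b⁻(m)`. -/
def bPMCoeff {r : ℕ} (m : Composition r) : ℤ :=
  if m.blocks = List.replicate r 1 then (-1) ^ (r + 1) * ((r : ℤ) + 1)
  else if m.blocks = List.replicate (r - 2) 1 ++ [2] then (-1) ^ r * ((r : ℤ) - 2)
  else (-1) ^ (m.length + 1) * (jIndex m : ℤ)

end Polyzeta

namespace Polyzeta

open Filter Topology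

/-! Polylogarithms are iterated integrals of dz/z and dz/(1 - z): raising the last exponent
integrates against dz/z, appending an exponent 1 against dz/(1 - z). Lists of exponents are reversed
so that differentiation acts on the head.

Write r = n + 2. Splitting the integral for ζ(r) over [0, 1] at a point z gives
`zeta_eq_sum_genFun`: ζ(r) is the sum of the products L_(k+1)(z) L_(1,…,1)(1 - z) over 0 ≤ k ≤ n +
1, with n + 1 - k ones, plus L_(1,…,1,2)(1 - z).

If all factors are taken at the same point, `sum_genFun_mul_genFun_ones` expands the products, with
signs ε = ±1, by the shuffle product: L_m occurs with the index j of m as multiplicity.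

At z = 1/2 one has 1 - z = z, and ε = 1 gives the first formula. At u = ρ^(±1) one has 1 - u = u /
(u - 1), so Landen's transformation (`landen_ones`, `landen_two`) moves the values at 1 - u back to
u. Its signs are the case ε = -1, and its extra terms account for the exceptional coefficients. Each
functional equation is proved by differentiation, then carried to the circle by continuity. -/

/-! ### Power series and their derivatives -/

/-- The coefficient of `z ^ N` in the polylogarithm whose list of exponents, read backwards,
is the given list. -/
noncomputable def coeff : List ℕ → ℕ → ℂ
  | [], N => if N = 0 then 1 else 0
  | s :: l, N => ((N : ℂ) ^ s)⁻¹ * ∑ n ∈ Finset.range N, coeff l n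

/-- The power series of the polylogarithm whose list of exponents, read backwards, is `l`. -/
noncomputable def genFun (l : List ℕ) (z : ℂ) : ℂ := ∑' n, coeff l n * z ^ n

/-- The sum over `Finset.range 0` is empty, so `s = 0` is covered although the factor is then 1. -/
lemma coeff_cons_zero (s : ℕ) (l : List ℕ) : coeff (s :: l) 0 = 0 := by simp [coeff]

lemma norm_natCast_pow_inv_le_one (n s : ℕ) : ‖((n : ℂ) ^ s)⁻¹‖ ≤ 1 := by
  rw [norm_inv, norm_pow, Complex.norm_natCast]
  rcases Nat.eq_zero_or_pos n with rfl | hn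
  · rcases Nat.eq_zero_or_pos s with rfl | hs
    · simp
    · simp [hs.ne']
  · exact inv_le_one_of_one_le₀ (one_le_pow₀ (by exact_mod_cast hn))

lemma norm_coeff_le (l : List ℕ) (N : ℕ) : ‖coeff l N‖ ≤ (N : ℝ) ^ l.length := by
  induction l generalizing N with
  | nil => by_cases h : N = 0 <;> simp [coeff, h]
  | cons s l ih =>
    rw [coeff, norm_mul, List.length_cons, pow_succ']
    have h2 : ‖∑ n ∈ Finset.range N, coeff l n‖ ≤ N * (N : ℝ) ^ l.length := by
      refine (norm_sum_le _ _).trans ((Finset.sum_le_card_nsmul _ _ ((N : ℝ) ^ l.length)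
        fun n hn => (ih n).trans ?_).trans ?_)
      · have := (Finset.mem_range.mp hn).le
        gcongr
      · simp
    calc _ ≤ 1 * ‖∑ n ∈ Finset.range N, coeff l n‖ := by
          gcongr; exact norm_natCast_pow_inv_le_one _ _
      _ ≤ _ := by rwa [one_mul]

lemma summable_pow_mul_norm (k : ℕ) {z : ℂ} (hz : ‖z‖ < 1) :
    Summable fun n : ℕ => (n : ℝ) ^ k * ‖z‖ ^ n :=
  summable_pow_mul_geometric_of_norm_lt_one k (by simpa using hz)

lemma summable_norm_coeff_mul_pow (l : List ℕ) {z : ℂ} (hz : ‖z‖ < 1) :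
    Summable fun n => ‖coeff l n * z ^ n‖ := by
  refine Summable.of_nonneg_of_le (fun _ => norm_nonneg _) (fun n => ?_)
    (summable_pow_mul_norm l.length hz)
  rw [norm_mul, norm_pow]
  gcongr
  exact norm_coeff_le l n

lemma genFun_nil (z : ℂ) : genFun [] z = 1 := by
  rw [genFun, tsum_eq_single 0]
  · simp [coeff]
  · intro n hn; simp [coeff, hn]

lemma genFun_zero {l : List ℕ} (hl : l ≠ []) : genFun l 0 = 0 := by
  obtain ⟨s, l, rfl⟩ := List.exists_cons_of_ne_nil hl
  rw [genFun, tsum_eq_single 0]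
  · simp [coeff]
  · intro n hn; simp [hn]

/-- Termwise differentiation of a power series with coefficients of polynomial growth. -/
lemma hasDerivAt_genFun (l : List ℕ) {z : ℂ} (hz : ‖z‖ < 1) :
    HasDerivAt (genFun l) (∑' n, coeff l n * (n * z ^ (n - 1))) z := by
  obtain ⟨R, hR, hR1⟩ := exists_between hz
  have hR0 : 0 ≤ R := (norm_nonneg z).trans hR.le
  have hu : Summable fun n : ℕ => (n : ℝ) ^ (l.length + 1) * R ^ (n - 1) := by
    rw [← summable_nat_add_iff 1]
    have h1 := summable_pow_mul_geometric_of_norm_lt_one (R := ℝ) (l.length + 1)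
      (r := R) (by rwa [Real.norm_of_nonneg hR0])
    have h0 : Summable fun n : ℕ => R ^ n := summable_geometric_of_lt_one hR0 hR1
    refine Summable.of_nonneg_of_le (fun n => by positivity) (fun n => ?_)
      ((h1.add h0).mul_left (2 ^ (l.length + 1)))
    -- The summand 1 on the right is there only for n = 0.
    have : ((n + 1 : ℕ) : ℝ) ^ (l.length + 1) ≤ 2 ^ (l.length + 1) * (n ^ (l.length + 1) + 1) := by
      rcases Nat.eq_zero_or_pos n with rfl | hn
      · simpa using one_le_pow₀ (one_le_two)
      · have h1 : ((n + 1 : ℕ) : ℝ) ≤ 2 * n := by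
          have : (1 : ℝ) ≤ n := by exact_mod_cast hn
          push_cast; linarith
        calc ((n + 1 : ℕ) : ℝ) ^ (l.length + 1) ≤ (2 * n) ^ (l.length + 1) := by gcongr
          _ = 2 ^ (l.length + 1) * n ^ (l.length + 1) := mul_pow _ _ _
          _ ≤ _ := by gcongr; linarith
    calc _ ≤ 2 ^ (l.length + 1) * (n ^ (l.length + 1) + 1) * R ^ n := by
          simp only [Nat.add_sub_cancel]; gcongr
      _ = _ := by ring
  refine hasDerivAt_tsum_of_isPreconnected hu Metric.isOpen_ball
    (convex_ball (0 : ℂ) R).isPreconnected (g := fun n z => coeff l n * z ^ n)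
    (fun n y _ => (hasDerivAt_pow n y).const_mul _) (fun n y hy => ?_)
    (Metric.mem_ball_self (lt_of_le_of_lt (norm_nonneg z) hR))
    (summable_norm_coeff_mul_pow l (by simp)).of_norm (by simpa using hR)
  have hy' : ‖y‖ ≤ R := by simpa using (Metric.mem_ball.mp hy).le
  rw [norm_mul, norm_mul, norm_pow, Complex.norm_natCast, pow_succ, mul_assoc]
  gcongr
  exact norm_coeff_le l n

/-- The case `s = 0` matters: `0 :: l` is no polylogarithm, but its coefficients are the partial
sums of those of `l`, which is how the factor 1 / (1 - z) arises in `hasDerivAt_genFun_one`. -/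
lemma natCast_mul_coeff (s : ℕ) (l : List ℕ) (n : ℕ) :
    (n : ℂ) * coeff ((s + 1) :: l) n = coeff (s :: l) n := by
  rcases Nat.eq_zero_or_pos n with rfl | hn
  · simp [coeff]
  · have : (n : ℂ) ≠ 0 := by exact_mod_cast hn.ne'
    simp only [coeff]; field_simp; ring

lemma hasDerivAt_genFun_succ (s : ℕ) (l : List ℕ) {z : ℂ} (hz : ‖z‖ < 1) (h0 : z ≠ 0) :
    HasDerivAt (genFun ((s + 1) :: l)) (genFun (s :: l) z / z) z := by
  convert hasDerivAt_genFun ((s + 1) :: l) hz using 1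
  rw [div_eq_iff h0, genFun, ← tsum_mul_right]
  refine tsum_congr fun n => ?_
  rw [← natCast_mul_coeff]
  rcases n with _ | n
  · simp
  · simp only [Nat.add_sub_cancel]; ring

lemma hasDerivAt_genFun_one (l : List ℕ) {z : ℂ} (hz : ‖z‖ < 1) :
    HasDerivAt (genFun (1 :: l)) (genFun l z / (1 - z)) z := by
  convert hasDerivAt_genFun (1 :: l) hz using 1
  have h1 : 1 - z ≠ 0 := by
    rintro h
    rw [← sub_eq_zero.mp h] at hz
    simp at hz
  have hs : Summable fun n : ℕ => coeff (0 :: l) n * z ^ n :=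
    (summable_norm_coeff_mul_pow _ hz).of_norm
  have hs1 : Summable fun n : ℕ => coeff (0 :: l) (n + 1) * z ^ n := by
    rcases eq_or_ne z 0 with rfl | h0
    · refine summable_of_ne_finset_zero (s := {0}) fun n hn => ?_
      simp at hn; simp [hn]
    · have := ((summable_nat_add_iff 1).mpr hs).mul_right z⁻¹
      refine this.congr fun n => ?_
      rw [pow_succ]; field_simp
  have hsum : ∑' n : ℕ, coeff (1 :: l) n * (n * z ^ (n - 1)) =
      ∑' n : ℕ, coeff (0 :: l) (n + 1) * z ^ n := by
    have key : ∀ n : ℕ, coeff (1 :: l) (n + 1) * ((n + 1 : ℕ) * z ^ (n + 1 - 1)) =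
        coeff (0 :: l) (n + 1) * z ^ n := fun n => by
      rw [← natCast_mul_coeff 0 l (n + 1), Nat.add_sub_cancel]; ring
    have hs2 : Summable fun n : ℕ => coeff (1 :: l) n * (n * z ^ (n - 1)) :=
      (summable_nat_add_iff 1).mp (hs1.congr fun n => (key n).symm)
    rw [hs2.tsum_eq_zero_add]
    simp [← key]
  rw [hsum, div_eq_iff h1, mul_one_sub, genFun, ← tsum_mul_right]
  have hz' : ∑' n : ℕ, coeff (0 :: l) (n + 1) * z ^ n * z = ∑' n : ℕ, coeff (0 :: l) n * z ^ n := by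
    rw [hs.tsum_eq_zero_add, coeff_cons_zero, zero_mul, zero_add]
    exact tsum_congr fun n => by ring
  -- Multiplication by 1 - z takes differences of consecutive partial sums, which recovers `coeff l
  -- n`.
  rw [hz', ← hs1.tsum_sub hs]
  refine tsum_congr fun n => ?_
  simp [coeff, Finset.sum_range_succ]; ring

lemma differentiableAt_genFun (l : List ℕ) {z : ℂ} (hz : ‖z‖ < 1) :
    DifferentiableAt ℂ (genFun l) z := (hasDerivAt_genFun l hz).differentiableAt

/-! ### Comparison with the sum over chains -/

lemma Chain.last_succ {k : ℕ} (c : Chain (k + 1)) : c.last = c.1 (Fin.last k) := by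
  simp [Chain.last]; rfl

lemma Chain.le_last {k : ℕ} (c : Chain k) (i : Fin k) : c.1 i ≤ c.last := by
  cases k with
  | zero => exact i.elim0
  | succ k => rw [Chain.last_succ]; exact c.2.1.monotone (Fin.le_last i)

/-- Removal of the last entry of a chain. -/
def Chain.init {k : ℕ} (c : Chain (k + 1)) : Chain k :=
  ⟨Fin.init c.1, fun _ _ h => c.2.1 (by simpa using h), fun i => c.2.2 i.castSucc⟩

lemma Chain.last_init_lt {k : ℕ} (c : Chain (k + 1)) : c.init.last < c.last := by
  cases k with
  | zero => rw [Chain.last_succ]; simpa [Chain.last] using c.2.2 0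
  | succ k =>
    rw [Chain.last_succ, Chain.last_succ]
    exact c.2.1 (Fin.castSucc_lt_last _)

/-- Extension of a chain by a new last entry. -/
def Chain.snoc {k : ℕ} (c : Chain k) (N : ℕ) (h : c.last < N) : Chain (k + 1) :=
  ⟨Fin.snoc (α := fun _ => ℕ) c.1 N, by
    constructor
    · intro i j hij
      induction j using Fin.lastCases with
      | last =>
        induction i using Fin.lastCases with
        | last => exact absurd hij (lt_irrefl _)
        | cast i => simpa using (c.le_last i).trans_lt h
      | cast j =>
        induction i using Fin.lastCases with
        | last => exact absurd hij (not_lt.mpr (Fin.le_last _))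
        | cast i => simpa using c.2.1 (by simpa using hij)
    · intro i
      induction i using Fin.lastCases with
      | last => simpa using (Nat.zero_le _).trans_lt h
      | cast i => simpa using c.2.2 i⟩

instance Chain.finite_last_eq (k N : ℕ) : Finite {c : Chain k // c.last = N} :=
  Finite.of_injective (β := Fin k → Fin (N + 1))
    (fun c i => ⟨c.1.1 i, Nat.lt_succ_of_le ((c.1.le_last i).trans_eq c.2)⟩) fun c d h => by
      apply Subtype.ext; apply Subtype.ext; funext i
      simpa using congrFun h i

noncomputable instance Chain.fintype_last_eq (k N : ℕ) : Fintype {c : Chain k // c.last = N} :=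
  Fintype.ofFinite _

/-- A chain with last entry `N` is a shorter chain with some last entry `n < N`. -/
def Chain.lastEquiv (k N : ℕ) :
    {c : Chain (k + 1) // c.last = N} ≃ Σ n : Fin N, {c : Chain k // c.last = n} where
  toFun c := ⟨⟨c.1.init.last, c.1.last_init_lt.trans_eq c.2⟩, c.1.init, rfl⟩
  invFun p := ⟨p.2.1.snoc N (p.2.2.trans_lt p.1.2), by rw [Chain.last_succ]; simp [Chain.snoc]⟩
  left_inv c := by
    obtain ⟨c, rfl⟩ := c
    apply Subtype.ext; apply Subtype.ext
    simp only [Chain.snoc, Chain.init, Chain.last_succ]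
    exact Fin.snoc_init_self c.1
  right_inv p := by
    obtain ⟨n, c⟩ := p
    revert n c
    suffices h : ∀ (n : ℕ) (hn : n < N) (c : Chain k) (hc : c.last = n),
        (⟨⟨(c.snoc N (hc.trans_lt hn)).init.last, (Chain.last_init_lt _).trans_eq (by
          rw [Chain.last_succ]; simp [Chain.snoc])⟩, (c.snoc N (hc.trans_lt hn)).init, rfl⟩ :
          Σ n : Fin N, {c : Chain k // c.last = n}) = ⟨⟨n, hn⟩, c, hc⟩ from
      fun n c => h n.1 n.2 c.1 c.2
    rintro n hn c rfl
    have : (c.snoc N hn).init = c := by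
      apply Subtype.ext
      simp only [Chain.snoc, Chain.init]
      exact Fin.init_snoc (α := fun _ => ℕ) _ _
    have aux : ∀ d : Chain k, d = c → ∀ h : d.last < N,
        (⟨⟨d.last, h⟩, d, rfl⟩ : Σ n : Fin N, {c : Chain k // c.last = n}) =
          ⟨⟨c.last, hn⟩, c, rfl⟩ := by
      rintro d rfl h; rfl
    exact aux _ this _

/-- The recursion defining `coeff` is the removal of the largest entry, via `Chain.lastEquiv`. -/
lemma sum_prod_last_eq {k : ℕ} (m : Fin k → ℕ) (N : ℕ) :
    ∑ c : {c : Chain k // c.last = N}, ∏ i, ((c.1.1 i : ℂ) ^ m i)⁻¹ =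
      coeff (List.ofFn m).reverse N := by
  induction k generalizing N with
  | zero =>
    simp only [Finset.univ_eq_empty, Finset.prod_empty, Finset.sum_const, List.ofFn_zero,
      List.reverse_nil, coeff]
    have hl (c : Chain 0) : c.last = 0 := by simp [Chain.last]
    by_cases h : N = 0
    · subst h
      have : Fintype.card {c : Chain 0 // c.last = 0} = 1 :=
        Fintype.card_eq_one_iff.mpr
          ⟨⟨⟨Fin.elim0, fun i => i.elim0, fun i => i.elim0⟩, hl _⟩, fun c => by
            apply Subtype.ext; apply Subtype.ext; funext i; exact i.elim0⟩
      simp [Finset.card_univ, this]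
    · have : IsEmpty {c : Chain 0 // c.last = N} := ⟨fun c => h (c.2.symm.trans (hl _))⟩
      simp [h]
  | succ k ih =>
    rw [List.ofFn_succ', List.concat_eq_append, List.reverse_append, List.reverse_singleton,
      List.singleton_append, coeff, ← (Chain.lastEquiv k N).symm.sum_comp, Fintype.sum_sigma,
      ← Fin.sum_univ_eq_sum_range (fun n => coeff (List.ofFn fun i => m i.castSucc).reverse n),
      Finset.mul_sum]
    refine Finset.sum_congr rfl fun n _ => ?_
    rw [← ih, Finset.mul_sum]
    refine Finset.sum_congr rfl fun c _ => ?_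
    rw [Fin.prod_univ_castSucc, mul_comm]
    simp [Chain.lastEquiv, Chain.snoc]

/-- Reduces absolute convergence at z to the series at ‖z‖, whose terms are nonnegative, so that
fibre sums of norms are again power series terms. -/
lemma polylogTerm_ofReal_norm {k : ℕ} (m : Fin k → ℕ) (z : ℂ) (n : Chain k) :
    ((‖polylogTerm m z n‖ : ℝ) : ℂ) = polylogTerm m (‖z‖ : ℝ) n := by
  simp [polylogTerm]

lemma sum_polylogTerm_last_eq {k : ℕ} (m : Fin k → ℕ) (z : ℂ) (N : ℕ) :
    ∑ c : {c : Chain k // c.last = N}, polylogTerm m z c.1 =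
      coeff (List.ofFn m).reverse N * z ^ N := by
  rw [← sum_prod_last_eq, Finset.sum_mul]
  exact Finset.sum_congr rfl fun c _ => by rw [polylogTerm, c.2]

lemma summable_norm_polylogTerm {k : ℕ} (m : Fin k → ℕ) {z : ℂ} (hz : ‖z‖ < 1) :
    Summable fun n => ‖polylogTerm m z n‖ := by
  rw [← (Equiv.sigmaFiberEquiv (Chain.last (k := k))).summable_iff,
    summable_sigma_of_nonneg fun _ => by simp only [Function.comp_apply]; positivity]
  refine ⟨fun N => Summable.of_finite, ?_⟩
  have h : Summable fun N => ‖coeff (List.ofFn m).reverse N * ((‖z‖ : ℝ) : ℂ) ^ N‖ :=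
    summable_norm_coeff_mul_pow _ (by simpa using hz)
  refine h.congr fun N => ?_
  rw [← sum_polylogTerm_last_eq, tsum_fintype]
  simp_rw [← polylogTerm_ofReal_norm]
  rw [← Complex.ofReal_sum, Complex.norm_real, Real.norm_of_nonneg (by positivity)]
  rfl

lemma polylogSeries_eq_genFun {k : ℕ} (m : Fin k → ℕ) {z : ℂ} (hz : ‖z‖ < 1) :
    polylogSeries m z = genFun (List.ofFn m).reverse z := by
  have hs := (summable_norm_polylogTerm m hz).of_norm
  have hs' := ((Equiv.sigmaFiberEquiv (Chain.last (k := k))).summable_iff).mpr hs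
  rw [polylogSeries, ← (Equiv.sigmaFiberEquiv (Chain.last (k := k))).tsum_eq, genFun]
  refine (hs'.tsum_sigma' fun N => Summable.of_finite).trans (tsum_congr fun N => ?_)
  rw [← sum_polylogTerm_last_eq, tsum_fintype]
  rfl

/-! ### Limits at boundary points -/

/-- The function g is bounded on U because its extension is bounded on the compact closure. Hence f
has bounded derivative on a convex set, is Lipschitz there, and extends to the plane. -/
lemma exists_continuous_eqOn_of_hasDerivAt {U : Set ℂ} (hU : Convex ℝ U)
    (hb : Bornology.IsBounded U) {f g c : ℂ → ℂ}
    (hg : ∃ h : ℂ → ℂ, Continuous h ∧ Set.EqOn g h U)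
    (hf : ∀ z ∈ U, HasDerivAt f (g z / c z) z) (hc : ∀ z ∈ U, 1 / 2 ≤ ‖c z‖) :
    ∃ h : ℂ → ℂ, Continuous h ∧ Set.EqOn f h U := by
  obtain ⟨h, hh, hgh⟩ := hg
  obtain ⟨M, hM⟩ := (hb.isCompact_closure.image hh).isBounded.exists_norm_le
  have hM' : ∀ z ∈ U, ‖g z‖ ≤ M := fun z hz => by
    rw [hgh hz]; exact hM _ (Set.mem_image_of_mem _ (subset_closure hz))
  have hlip : LipschitzOnWith (2 * M).toNNReal f U := by
    refine hU.lipschitzOnWith_of_nnnorm_deriv_le (𝕜 := ℂ)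
      (fun z hz => (hf z hz).differentiableAt) fun z hz => ?_
    have h0 : 0 ≤ M := (norm_nonneg _).trans (hM' z hz)
    have hcz := hc z hz
    rw [← NNReal.coe_le_coe, coe_nnnorm, Real.coe_toNNReal _ (by positivity), (hf z hz).deriv,
      norm_div, div_le_iff₀ (by linarith)]
    nlinarith [hM' z hz]
  obtain ⟨k, hk, hfk⟩ := hlip.extend_finite_dimension
  exact ⟨k, hk.continuous, hfk⟩

/-- Since u has distance 1 from both 0 and 1, the denominators z and 1 - z stay at least 1/2 in
absolute value on the ball of radius 1/2 about u. The induction is on the list and, inside, on its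
head, starting from head 1. -/
lemma exists_continuous_eqOn_genFun {u : ℂ} (h0 : ‖u‖ = 1) (h1 : ‖1 - u‖ = 1) {l : List ℕ}
    (hl : ∀ s ∈ l, 0 < s) :
    ∃ h : ℂ → ℂ, Continuous h ∧
      Set.EqOn (genFun l) h (Metric.ball 0 1 ∩ Metric.ball u (1 / 2)) := by
  have hU : Convex ℝ (Metric.ball (0 : ℂ) 1 ∩ Metric.ball u (1 / 2)) :=
    (convex_ball _ _).inter (convex_ball _ _)
  have hb : Bornology.IsBounded (Metric.ball (0 : ℂ) 1 ∩ Metric.ball u (1 / 2)) :=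
    Metric.isBounded_ball.subset Set.inter_subset_left
  have hz0 : ∀ z ∈ Metric.ball (0 : ℂ) 1 ∩ Metric.ball u (1 / 2), 1 / 2 ≤ ‖z‖ := fun z hz => by
    have h2 := mem_ball_iff_norm'.mp hz.2
    have := norm_sub_norm_le u z
    linarith
  have hz1 : ∀ z ∈ Metric.ball (0 : ℂ) 1 ∩ Metric.ball u (1 / 2), 1 / 2 ≤ ‖1 - z‖ := fun z hz => by
    have h2 := mem_ball_iff_norm.mp hz.2
    have := norm_sub_norm_le (1 - u) (z - u)
    rw [show 1 - u - (z - u) = 1 - z by ring] at this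
    linarith
  induction l with
  | nil => exact ⟨fun _ => 1, continuous_const, fun z _ => genFun_nil z⟩
  | cons s l ih =>
    have hs : 0 < s := hl s (by simp)
    obtain ⟨s, rfl⟩ : ∃ t, s = t + 1 := ⟨s - 1, by omega⟩
    clear hs
    have ih := ih fun t ht => hl t (by simp [ht])
    clear hl
    induction s with
    | zero =>
      exact exists_continuous_eqOn_of_hasDerivAt hU hb ih
        (fun z hz => hasDerivAt_genFun_one l (mem_ball_zero_iff.mp hz.1)) hz1
    | succ s ih' =>
      refine exists_continuous_eqOn_of_hasDerivAt hU hb ih'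
        (fun z hz => hasDerivAt_genFun_succ (s + 1) l (mem_ball_zero_iff.mp hz.1) ?_) hz0
      rintro rfl
      have := hz0 0 hz
      norm_num at this

lemma exists_tendsto_genFun {u : ℂ} (h0 : ‖u‖ = 1) (h1 : ‖1 - u‖ = 1) {l : List ℕ}
    (hl : ∀ s ∈ l, 0 < s) :
    ∃ y, Tendsto (genFun l) (𝓝[Metric.ball 0 1] u) (𝓝 y) := by
  obtain ⟨h, hh, heq⟩ := exists_continuous_eqOn_genFun h0 h1 hl
  refine ⟨h u, Tendsto.congr' ?_ (hh.continuousAt.mono_left nhdsWithin_le_nhds)⟩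
  filter_upwards [self_mem_nhdsWithin,
    mem_nhdsWithin_of_mem_nhds (Metric.ball_mem_nhds u (by norm_num : (0 : ℝ) < 1 / 2))]
    with z hz hz' using (heq ⟨hz, hz'⟩).symm

lemma polylog_eq_genFun {r : ℕ} (m : Composition r) {z : ℂ} (hz : ‖z‖ < 1) :
    polylog m.blocksFun z = genFun m.blocks.reverse z := by
  rw [polylog, if_pos hz, polylogSeries_eq_genFun _ hz, Composition.ofFn_blocksFun]

lemma tendsto_polylogSeries {r : ℕ} (m : Composition r) {u : ℂ} (h0 : ‖u‖ = 1)
    (h1 : ‖1 - u‖ = 1) :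
    Tendsto (polylogSeries m.blocksFun) (𝓝[Metric.ball 0 1] u) (𝓝 (polylog m.blocksFun u)) := by
  rw [polylog, if_neg (by simp [h0])]
  apply tendsto_extendFrom
  obtain ⟨y, hy⟩ := exists_tendsto_genFun h0 h1 (l := m.blocks.reverse)
    fun s hs => m.blocks_pos (by simpa using hs)
  refine ⟨y, hy.congr' ?_⟩
  filter_upwards [self_mem_nhdsWithin] with z hz
  rw [polylogSeries_eq_genFun _ (mem_ball_zero_iff.mp hz), Composition.ofFn_blocksFun]

lemma tendsto_genFun_polylog {r : ℕ} (m : Composition r) {u : ℂ} (h0 : ‖u‖ = 1)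
    (h1 : ‖1 - u‖ = 1) :
    Tendsto (genFun m.blocks.reverse) (𝓝[Metric.ball 0 1] u) (𝓝 (polylog m.blocksFun u)) := by
  refine (tendsto_polylogSeries m h0 h1).congr' ?_
  filter_upwards [self_mem_nhdsWithin] with z hz
  rw [polylogSeries_eq_genFun _ (mem_ball_zero_iff.mp hz), Composition.ofFn_blocksFun]

/-! ### Functional equations -/

/-- The derivative formulas involve division by z and say nothing at 0; continuity of the derivative
of a holomorphic function fills in that point. -/
lemma eq_zero_of_deriv_eq_zero {U : Set ℂ} (hU : IsOpen U) (hc : IsPreconnected U)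
    (h0 : (0 : ℂ) ∈ U) {h : ℂ → ℂ} (hd : ∀ z ∈ U, DifferentiableAt ℂ h z)
    (hh : ∀ z ∈ U, z ≠ 0 → deriv h z = 0) (hz : h 0 = 0) {z : ℂ} (hzU : z ∈ U) : h z = 0 := by
  have hdU : DifferentiableOn ℂ h U := fun z hz => (hd z hz).differentiableWithinAt
  have hcont : ContinuousAt (deriv h) 0 :=
    (hdU.deriv hU).continuousOn.continuousAt (hU.mem_nhds h0)
  have h00 : deriv h 0 = 0 := by
    refine tendsto_nhds_unique (hcont.mono_left (nhdsWithin_le_nhds (s := {0}ᶜ)))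
      (tendsto_const_nhds.congr' ?_)
    filter_upwards [self_mem_nhdsWithin, mem_nhdsWithin_of_mem_nhds (hU.mem_nhds h0)]
      with w hw hwU using (hh w hwU hw).symm
  rw [← hz]
  refine hU.is_const_of_deriv_eq_zero hc hdU (fun w hw => ?_) hzU h0
  rcases eq_or_ne w 0 with rfl | hw0
  · exact h00
  · exact hh w hw hw0

/-! ### Landen's transformation -/

lemma one_sub_ne_zero_of_norm_lt {z : ℂ} (hz : ‖z‖ < 1) : 1 - z ≠ 0 := by
  intro h
  rw [← sub_eq_zero.mp h] at hz
  simp at hz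

/-- The inequality |z| < |z - 1| is the half-plane condition Re z < 1/2. -/
lemma norm_div_sub_one_lt {z : ℂ} (hz : ‖z‖ < 1) (hre : z.re < 1 / 2) : ‖z / (z - 1)‖ < 1 := by
  have h1 : z - 1 ≠ 0 := sub_ne_zero.mpr fun h => by simp [h] at hz
  rw [norm_div, div_lt_one (norm_pos_iff.mpr h1)]
  refine lt_of_pow_lt_pow_left₀ 2 (norm_nonneg _) ?_
  rw [Complex.sq_norm, Complex.sq_norm, Complex.normSq_apply, Complex.normSq_apply]
  simp
  nlinarith

lemma hasDerivAt_div_sub_one {z : ℂ} (h1 : z - 1 ≠ 0) :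
    HasDerivAt (fun z : ℂ => z / (z - 1)) (-1 / (z - 1) ^ 2) z := by
  refine ((hasDerivAt_id z).div ((hasDerivAt_id z).sub_const 1) h1).congr_deriv ?_
  simp

/-- The half disc on which both sides of Landen's transformation `z ↦ z / (z - 1)` are defined. -/
def landenDomain : Set ℂ := Metric.ball 0 1 ∩ {z | z.re < 1 / 2}

lemma isOpen_landenDomain : IsOpen landenDomain :=
  Metric.isOpen_ball.inter (isOpen_lt Complex.continuous_re continuous_const)

lemma isPreconnected_landenDomain : IsPreconnected landenDomain :=
  ((convex_ball _ _).inter (convex_halfSpace_re_lt _)).isPreconnected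

lemma zero_mem_landenDomain : (0 : ℂ) ∈ landenDomain := by
  constructor <;> simp

/-- With w = z / (z - 1) one has dw / (1 - w) = -dz / (1 - z), so each integration contributes one
sign. -/
lemma landen_ones (n : ℕ) {z : ℂ} (hz : z ∈ landenDomain) :
    genFun (List.replicate n 1) (z / (z - 1)) = (-1) ^ n * genFun (List.replicate n 1) z := by
  induction n generalizing z with
  | zero => simp [genFun_nil]
  | succ n ih =>
    rw [List.replicate_succ, ← sub_eq_zero]
    have hD : ∀ z ∈ landenDomain, HasDerivAt (fun z => genFun (1 :: List.replicate n 1) (z / (z - 1))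
        - (-1) ^ (n + 1) * genFun (1 :: List.replicate n 1) z) 0 z := fun z hz => by
      have hz1 : ‖z‖ < 1 := mem_ball_zero_iff.mp hz.1
      have h1 : 1 - z ≠ 0 := one_sub_ne_zero_of_norm_lt hz1
      have h2 : z - 1 ≠ 0 := by rw [← neg_sub]; exact neg_ne_zero.mpr h1
      have hw := hasDerivAt_genFun_one (List.replicate n 1) (norm_div_sub_one_lt hz1 hz.2)
      refine ((hw.comp z (hasDerivAt_div_sub_one h2)).sub
        ((hasDerivAt_genFun_one (List.replicate n 1) hz1).const_mul ((-1) ^ (n + 1)))).congr_deriv ?_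
      rw [ih hz, show 1 - z / (z - 1) = (1 - z)⁻¹ by field_simp; ring,
        show (z - 1) ^ 2 = (1 - z) ^ 2 by ring]
      field_simp
      ring
    refine eq_zero_of_deriv_eq_zero isOpen_landenDomain isPreconnected_landenDomain
      zero_mem_landenDomain (fun z hz => (hD z hz).differentiableAt) (fun z hz _ => (hD z hz).deriv)
      ?_ hz
    simp [genFun_zero]

/-- Here dw / w = dz / z + dz / (1 - z); the second form produces the additional all-ones term. -/
lemma landen_two (n : ℕ) {z : ℂ} (hz : z ∈ landenDomain) :
    genFun (2 :: List.replicate n 1) (z / (z - 1)) = (-1) ^ (n + 1) *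
      (genFun (2 :: List.replicate n 1) z + genFun (List.replicate (n + 2) 1) z) := by
  rw [← sub_eq_zero]
  refine eq_zero_of_deriv_eq_zero isOpen_landenDomain isPreconnected_landenDomain
      zero_mem_landenDomain (h := fun z => genFun (2 :: List.replicate n 1) (z / (z - 1)) -
      (-1) ^ (n + 1) * (genFun (2 :: List.replicate n 1) z + genFun (List.replicate (n + 2) 1) z))
      (fun z hz => ?_) (fun z hz h0 => ?_) ?_ hz
  · have hz1 : ‖z‖ < 1 := mem_ball_zero_iff.mp hz.1
    have h2 : z - 1 ≠ 0 := by
      rw [← neg_sub]; exact neg_ne_zero.mpr (one_sub_ne_zero_of_norm_lt hz1)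
    exact ((differentiableAt_genFun _ (norm_div_sub_one_lt hz1 hz.2)).comp z
      (hasDerivAt_div_sub_one h2).differentiableAt).sub
      (((differentiableAt_genFun _ hz1).add (differentiableAt_genFun _ hz1)).const_mul _)
  · have hz1 : ‖z‖ < 1 := mem_ball_zero_iff.mp hz.1
    have h1 : 1 - z ≠ 0 := one_sub_ne_zero_of_norm_lt hz1
    have h2 : z - 1 ≠ 0 := by rw [← neg_sub]; exact neg_ne_zero.mpr h1
    have hw := hasDerivAt_genFun_succ 1 (List.replicate n 1) (norm_div_sub_one_lt hz1 hz.2)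
      (div_ne_zero h0 h2)
    have hd := (hw.comp z (hasDerivAt_div_sub_one h2)).sub
      (((hasDerivAt_genFun_succ 1 (List.replicate n 1) hz1 h0).add
        (hasDerivAt_genFun_one (List.replicate (n + 1) 1) hz1)).const_mul ((-1) ^ (n + 1)))
    refine hd.deriv.trans ?_
    have := landen_ones (n + 1) hz
    rw [List.replicate_succ] at this
    rw [this, List.replicate_succ, show 1 - z = -(z - 1) by ring]
    field_simp
    ring
  · simp [genFun_zero]

/-! ### The path composition formula -/

lemma genFun_singleton (k : ℕ) (z : ℂ) :
    genFun [k + 1] z = ∑' n : ℕ, ((n : ℂ) ^ (k + 1))⁻¹ * z ^ n := by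
  refine tsum_congr fun n => ?_
  rcases Nat.eq_zero_or_pos n with rfl | hn
  · simp [coeff]
  · simp [coeff, hn]

/-- A logarithmic bound near 1, uniform in the exponent, obtained by comparison with exponent 1. -/
lemma norm_genFun_singleton_le (k : ℕ) {z : ℂ} (hz : ‖z‖ < 1) :
    ‖genFun [k + 1] z‖ ≤ -Real.log (1 - ‖z‖) := by
  rw [genFun_singleton]
  have h := Real.hasSum_pow_div_log_of_abs_lt_one (x := ‖z‖) (by simpa using hz)
  have h' : HasSum (fun n : ℕ => ‖z‖ ^ n / (n : ℝ)) (-Real.log (1 - ‖z‖)) := by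
    rw [← hasSum_nat_add_iff' 1]
    simpa using h
  refine tsum_of_norm_bounded h' fun n => ?_
  rw [norm_mul, norm_inv, norm_pow, norm_pow, Complex.norm_natCast, mul_comm, div_eq_mul_inv]
  refine mul_le_mul_of_nonneg_left ?_ (by positivity)
  rcases Nat.eq_zero_or_pos n with rfl | hn
  · simp
  · have : (1 : ℝ) ≤ n := by exact_mod_cast hn
    gcongr
    exact le_self_pow₀ this (by omega)

lemma tendsto_genFun_singleton_one (n : ℕ) :
    Tendsto (fun t : ℝ => genFun [n + 2] (1 - t)) (𝓝[>] 0) (𝓝 (riemannZeta (n + 2 : ℕ))) := by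
  rw [zeta_nat_eq_tsum_of_gt_one (by omega)]
  simp_rw [genFun_singleton (n + 1)]
  have hs : Summable fun k : ℕ => ((k : ℝ) ^ (n + 2))⁻¹ :=
    Real.summable_nat_pow_inv.mpr (by omega)
  refine tendsto_tsum_of_dominated_convergence hs (fun k => ?_) ?_
  · have : Tendsto (fun t : ℝ => ((k : ℂ) ^ (n + 1 + 1))⁻¹ * (1 - (t : ℂ)) ^ k) (𝓝 0)
        (𝓝 (((k : ℂ) ^ (n + 1 + 1))⁻¹ * (1 - ((0 : ℝ) : ℂ)) ^ k)) := by
      apply Continuous.tendsto; fun_prop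
    simpa using this.mono_left nhdsWithin_le_nhds
  · filter_upwards [Ioo_mem_nhdsGT (zero_lt_one' ℝ)] with t ht k
    rw [norm_mul, norm_inv, norm_pow, norm_pow, Complex.norm_natCast]
    have : ‖(1 : ℂ) - t‖ ≤ 1 := by
      rw [← Complex.ofReal_one, ← Complex.ofReal_sub, Complex.norm_real, Real.norm_eq_abs, abs_le]
      constructor <;> linarith [ht.1, ht.2]
    exact mul_le_of_le_one_right (by positivity) (pow_le_one₀ (norm_nonneg _) this)

/-- The first factor is O(log t), the second O(t) since it vanishes at 0, and t log t tends to 0. -/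
lemma tendsto_genFun_mul_genFun (k : ℕ) {l : List ℕ} (hl : l ≠ []) :
    Tendsto (fun t : ℝ => genFun [k + 1] (1 - t) * genFun l t) (𝓝[>] 0) (𝓝 0) := by
  have hO : (fun t : ℝ => genFun l t) =O[𝓝[>] 0] fun t : ℝ => t := by
    have h := (hasDerivAt_genFun l (z := 0) (by simp)).isBigO_sub
    simp only [genFun_zero hl, sub_zero] at h
    have ht : Tendsto (fun t : ℝ => (t : ℂ)) (𝓝[>] 0) (𝓝 0) := by
      simpa using (Complex.continuous_ofReal.tendsto 0).mono_left nhdsWithin_le_nhds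
    have := h.comp_tendsto ht
    exact this.trans (Asymptotics.isBigO_of_le _ fun t => by simp)
  have hL : (fun t : ℝ => genFun [k + 1] (1 - t)) =O[𝓝[>] 0] fun t : ℝ => Real.log t := by
    refine Asymptotics.IsBigO.of_bound 1 ?_
    filter_upwards [Ioo_mem_nhdsGT (zero_lt_one' ℝ)] with t ht
    have hn : ‖(1 : ℂ) - t‖ = 1 - t := by
      rw [← Complex.ofReal_one, ← Complex.ofReal_sub, Complex.norm_real, Real.norm_of_nonneg]
      linarith [ht.2]
    have := norm_genFun_singleton_le k (z := 1 - t) (by rw [hn]; linarith [ht.1])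
    rw [hn, sub_sub_cancel] at this
    rw [one_mul]
    exact this.trans (neg_le_abs _)
  refine (hL.mul hO).trans_tendsto ?_
  have := (Real.continuous_mul_log.tendsto 0).mono_left (nhdsWithin_le_nhds (s := Set.Ioi 0))
  simpa [mul_comm] using this

/-- The path composition formula for `ζ(n + 2)` at an intermediate point `z`. -/
lemma zeta_eq_sum_genFun (n : ℕ) {z : ℂ} (hz : ‖z‖ < 1) (hz' : ‖1 - z‖ < 1) :
    riemannZeta (n + 2 : ℕ) = ∑ k ∈ Finset.range (n + 2),
      genFun [k + 1] z * genFun (List.replicate (n + 1 - k) 1) (1 - z)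
      + genFun (2 :: List.replicate n 1) (1 - z) := by
  set A : ℂ → ℂ := fun z => ∑ k ∈ Finset.range (n + 2),
      genFun [k + 1] z * genFun (List.replicate (n + 1 - k) 1) (1 - z)
      + genFun (2 :: List.replicate n 1) (1 - z) with hA
  -- The 1/z terms of consecutive k cancel in pairs; the 1 / (1 - z) term from k = 0 cancels the
  -- derivative of the last summand.
  have hD : ∀ z : ℂ, ‖z‖ < 1 → ‖1 - z‖ < 1 → HasDerivAt A 0 z := by
    intro z hz hz'
    have h0 : z ≠ 0 := by rintro rfl; simp at hz'
    have h1 := one_sub_ne_zero_of_norm_lt hz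
    have hsub : HasDerivAt (fun z : ℂ => 1 - z) (-1) z := by
      simpa using (hasDerivAt_id z).const_sub 1
    have hf : ∀ k : ℕ, HasDerivAt (genFun [k + 1])
        (match k with | 0 => 1 / (1 - z) | k + 1 => genFun [k + 1] z / z) z := fun k => by
      cases k with
      | zero => simpa [genFun_nil] using hasDerivAt_genFun_one [] hz
      | succ k => exact hasDerivAt_genFun_succ (k + 1) [] hz h0
    have hg : ∀ k : ℕ, HasDerivAt (fun z => genFun (List.replicate k 1) (1 - z))
        (match k with | 0 => 0 | k + 1 => -(genFun (List.replicate k 1) (1 - z) / z)) z := fun k => by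
      cases k with
      | zero => simpa [genFun_nil] using hasDerivAt_const z (1 : ℂ)
      | succ k =>
        refine ((hasDerivAt_genFun_one (List.replicate k 1) hz').comp z hsub).congr_deriv ?_
        rw [sub_sub_cancel]; ring
    have hlast := (hasDerivAt_genFun_succ 1 (List.replicate n 1) hz' h1).comp z hsub
    have hsum := (HasDerivAt.fun_sum (u := Finset.range (n + 2)) fun k _ =>
      (hf k).mul (hg (n + 1 - k))).add hlast
    refine hsum.congr_deriv ?_
    rw [Finset.sum_add_distrib, Finset.sum_range_succ', Finset.sum_range_succ (n := n + 1)]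
    have h3 : ∀ k ∈ Finset.range (n + 1), genFun [k + 1] z *
        (match n + 1 - k with | 0 => 0 | j + 1 => -(genFun (List.replicate j 1) (1 - z) / z)) =
        -(genFun [k + 1] z / z * genFun (List.replicate (n + 1 - (k + 1)) 1) (1 - z)) := by
      intro k hk
      have : n + 1 - k = (n + 1 - (k + 1)) + 1 := by
        have := Finset.mem_range.mp hk
        omega
      rw [this]
      simp only
      ring
    rw [Finset.sum_congr rfl h3, Finset.sum_neg_distrib]
    simp [List.replicate_succ]
    ring
  have hconst : ∀ w : ℂ, ‖w‖ < 1 → ‖1 - w‖ < 1 → A w = A z := by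
    intro w hw hw'
    have hmem : ∀ z : ℂ, z ∈ Metric.ball (0 : ℂ) 1 ∩ Metric.ball 1 1 ↔ ‖z‖ < 1 ∧ ‖1 - z‖ < 1 :=
      fun z => by rw [Set.mem_inter_iff, mem_ball_zero_iff, mem_ball_iff_norm']
    refine (Metric.isOpen_ball.inter Metric.isOpen_ball).is_const_of_deriv_eq_zero
      (s := Metric.ball (0 : ℂ) 1 ∩ Metric.ball 1 1)
      ((convex_ball _ _).inter (convex_ball _ _)).isPreconnected (fun v hv => ?_) (fun v hv => ?_)
      ((hmem w).mpr ⟨hw, hw'⟩) ((hmem z).mpr ⟨hz, hz'⟩)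
    · exact (hD v ((hmem v).mp hv).1 ((hmem v).mp hv).2).differentiableAt.differentiableWithinAt
    · exact (hD v ((hmem v).mp hv).1 ((hmem v).mp hv).2).deriv
  -- As z = 1 - t tends to 1, only the product with k = n + 1 survives, its second factor being 1.
  have hlim : Tendsto (fun t : ℝ => A (1 - t)) (𝓝[>] 0) (𝓝 (riemannZeta (n + 2 : ℕ))) := by
    have hlast : Tendsto (fun t : ℝ => genFun (2 :: List.replicate n 1) t) (𝓝[>] 0) (𝓝 0) := by
      have h := (differentiableAt_genFun (2 :: List.replicate n 1) (z := ((0 : ℝ) : ℂ))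
        (by simp)).continuousAt.comp Complex.continuous_ofReal.continuousAt
      have := h.tendsto.mono_left (nhdsWithin_le_nhds (s := Set.Ioi 0))
      simpa [genFun_zero, Function.comp_def] using this
    have hsum := (((tendsto_finsetSum (Finset.range (n + 1)) fun k hk =>
      tendsto_genFun_mul_genFun k (l := List.replicate (n + 1 - k) 1) (by
        have := Finset.mem_range.mp hk
        simp; omega)).add (tendsto_genFun_singleton_one n)).add hlast)
    simp only [Finset.sum_const_zero, zero_add, add_zero] at hsum
    refine hsum.congr fun t => ?_
    simp only [hA]
    rw [Finset.sum_range_succ (n := n + 1)]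
    simp [genFun_nil]
  refine tendsto_nhds_unique hlim (tendsto_const_nhds.congr' ?_)
  filter_upwards [Ioo_mem_nhdsGT (zero_lt_one' ℝ)] with t ht
  refine (hconst _ ?_ ?_).symm
  · rw [← Complex.ofReal_one, ← Complex.ofReal_sub, Complex.norm_real, Real.norm_eq_abs, abs_lt]
    constructor <;> linarith [ht.1, ht.2]
  · rw [sub_sub_cancel, Complex.norm_real, Real.norm_eq_abs, abs_lt]
    constructor <;> linarith [ht.1, ht.2]

/-! ### Compositions -/

/-- The composition with an additional last part `1`. -/
def appendOne {n : ℕ} (m : Composition n) : Composition (n + 1) where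
  blocks := m.blocks ++ [1]
  blocks_pos := fun {i} hi => by
    rcases List.mem_append.mp hi with h | h
    · exact m.blocks_pos h
    · simp at h; omega
  blocks_sum := by simp

/-- Increment the first entry of a list. -/
def incHead : List ℕ → List ℕ
  | [] => []
  | s :: l => (s + 1) :: l

lemma incHead_injective : Function.Injective incHead := by
  rintro (_ | ⟨s, l⟩) (_ | ⟨t, k⟩) h <;> simp_all [incHead]

lemma exists_reverse_blocks_eq {n : ℕ} (m : Composition (n + 1)) :
    ∃ s l, m.blocks.reverse = (s + 1) :: l := by
  rcases h : m.blocks.reverse with _ | ⟨s, l⟩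
  · have := m.blocks_sum
    simp [List.reverse_eq_nil_iff.mp h] at this
  · have : 0 < s := m.blocks_pos (List.mem_reverse.mp (by simp [h]))
    exact ⟨s - 1, l, by rw [Nat.sub_add_cancel this]⟩

/-- The composition with the last part increased by `1`. -/
def succLast {n : ℕ} (m : Composition (n + 1)) : Composition (n + 2) where
  blocks := (incHead m.blocks.reverse).reverse
  blocks_pos := fun {i} hi => by
    obtain ⟨s, l, h⟩ := exists_reverse_blocks_eq m
    rw [h, List.mem_reverse, incHead, List.mem_cons] at hi
    rcases hi with rfl | hi
    · omega
    · exact m.blocks_pos (List.mem_reverse.mp (by simp [h, hi]))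
  blocks_sum := by
    obtain ⟨s, l, h⟩ := exists_reverse_blocks_eq m
    have := m.blocks_sum
    rw [← List.sum_reverse, h, List.sum_cons] at this
    rw [List.sum_reverse, h, incHead, List.sum_cons]
    omega

/-- The two constructions mirror the two differential forms. They are jointly injective, and
surjectivity follows by counting, as the number of compositions doubles. -/
lemma sum_composition_succ {M : Type*} [AddCommMonoid M] (n : ℕ) (f : Composition (n + 2) → M) :
    ∑ m, f m = ∑ m : Composition (n + 1), (f (appendOne m) + f (succLast m)) := by
  have hinj : Function.Injective (Sum.elim (appendOne (n := n + 1)) (succLast (n := n))) := by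
    -- The last part is 1 on one side and at least 2 on the other.
    have hne (m m' : Composition (n + 1)) : appendOne m ≠ succLast m' := fun h => by
      have h := congrArg (fun c => c.blocks.reverse) h
      obtain ⟨s, l, hs⟩ := exists_reverse_blocks_eq m'
      simp [appendOne, succLast, hs, incHead] at h
    rintro (m | m) (m' | m') h
    · have := congrArg Composition.blocks h
      simp only [Sum.elim_inl, appendOne, List.append_cancel_right_eq] at this
      rw [Composition.ext this]
    · exact absurd h (hne _ _)
    · exact absurd h.symm (hne _ _)
    · have := congrArg Composition.blocks h
      simp only [Sum.elim_inr, succLast] at this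
      rw [Composition.ext (List.reverse_injective (incHead_injective (List.reverse_injective this)))]
  have hbij := (Fintype.bijective_iff_injective_and_card _).mpr ⟨hinj, by
    simp [composition_card, pow_succ, mul_two]⟩
  rw [← hbij.sum_comp, Fintype.sum_sum_type, Finset.sum_add_distrib]
  rfl

/-! ### The index of the first part different from `1` -/

lemma blocks_eq_replicate_iff {r : ℕ} (m : Composition r) :
    m.blocks = List.replicate r 1 ↔
      m.blocks.findIdx (fun t => decide (2 ≤ t)) = m.blocks.length := by
  rw [List.findIdx_eq_length]
  constructor
  · intro h
    rw [h]
    intro t ht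
    simp [List.eq_of_mem_replicate ht]
  · intro h
    have h1 : m.blocks = List.replicate m.blocks.length 1 :=
      List.eq_replicate_iff.mpr ⟨rfl, fun t ht => by
        have := h t ht
        have := m.blocks_pos ht
        simp at *
        omega⟩
    have h2 := m.blocks_sum
    rw [h1, List.sum_replicate, smul_eq_mul, mul_one] at h2
    rwa [h2] at h1

/-- For all ones `findIdx` returns the length, so adding 1 overshoots and the minimum corrects it.
-/
lemma jIndex_eq_min {r : ℕ} (m : Composition r) :
    jIndex m = min m.blocks.length (m.blocks.findIdx (fun t => decide (2 ≤ t)) + 1) := by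
  rw [jIndex]
  split_ifs with h
  · rw [(blocks_eq_replicate_iff m).mp h, h]
    simp
  · have := mt (blocks_eq_replicate_iff m).mpr h
    have := List.findIdx_le_length (p := fun t => decide (2 ≤ t)) (xs := m.blocks)
    omega

/-- The right side does not involve `a`: a hit at the last place and no hit at all give the same
minimum. This makes the index insensitive to increasing the last part. -/
lemma min_length_findIdx_append_singleton (p : ℕ → Bool) (l : List ℕ) (a : ℕ) :
    min (l ++ [a]).length ((l ++ [a]).findIdx p + 1) =
      if l.findIdx p < l.length then l.findIdx p + 1 else l.length + 1 := by
  rw [List.findIdx_append, List.length_append, List.length_singleton]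
  split_ifs <;> omega

lemma jIndex_appendOne {n : ℕ} (m : Composition n) :
    jIndex (appendOne m) = jIndex m + if m = Composition.ones n then 1 else 0 := by
  have hm : m = Composition.ones n ↔ m.blocks = List.replicate n 1 := Composition.ext_iff
  have hb : (appendOne m).blocks = m.blocks ++ [1] := rfl
  have := List.findIdx_le_length (p := fun t => decide (2 ≤ t)) (xs := m.blocks)
  rw [jIndex_eq_min, jIndex_eq_min, hb, min_length_findIdx_append_singleton]
  simp only [hm, blocks_eq_replicate_iff]
  split_ifs <;> omega

lemma jIndex_succLast {n : ℕ} (m : Composition (n + 1)) : jIndex (succLast m) = jIndex m := by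
  obtain ⟨s, l, h⟩ := exists_reverse_blocks_eq m
  have hb : m.blocks = l.reverse ++ [s + 1] := by
    rw [← List.reverse_reverse m.blocks, h, List.reverse_cons]
  have hb' : (succLast m).blocks = l.reverse ++ [s + 1 + 1] := by
    simp [succLast, h, incHead]
  rw [jIndex_eq_min, jIndex_eq_min, hb, hb', min_length_findIdx_append_singleton,
    min_length_findIdx_append_singleton]

/-! ### The shuffle product -/

/-- Expansion of `∑ ε ^ (n - k) L_{k + 1} L_{(1, …, 1)}`, with `n - k` entries `1` and `ε = ±1`,
as a linear combination of polylogarithms. -/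
lemma sum_genFun_mul_genFun_ones {ε : ℂ} (hε : ε ^ 2 = 1) (n : ℕ) {z : ℂ} (hz : ‖z‖ < 1) :
    ∑ k ∈ Finset.range (n + 1),
      ε ^ (n - k) * (genFun [k + 1] z * genFun (List.replicate (n - k) 1) z) =
    ∑ m : Composition (n + 1), ε ^ (m.length + 1) * jIndex m * genFun m.blocks.reverse z := by
  induction n generalizing z with
  | zero =>
    have : ∀ m : Composition 1, m = Composition.ones 1 := fun m => by
      have := Fintype.card_le_one_iff.mp (composition_card 1).le
      exact this _ _
    rw [Fintype.sum_eq_single (Composition.ones 1) fun m hm => absurd (this m) hm]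
    rw [Composition.ones_length, hε]
    -- Both sides are L_1(z): the only composition of 1 has length 1, and its sign ε ^ 2 is 1.
    simp [genFun_nil, jIndex, Composition.ones]
  | succ n ih =>
    rw [sum_composition_succ, ← sub_eq_zero]
    refine eq_zero_of_deriv_eq_zero (U := Metric.ball 0 1)
      (h := fun z => ∑ k ∈ Finset.range (n + 1 + 1),
        ε ^ (n + 1 - k) * (genFun [k + 1] z * genFun (List.replicate (n + 1 - k) 1) z) -
        ∑ m : Composition (n + 1),
        (ε ^ ((appendOne m).length + 1) * jIndex (appendOne m) *
            genFun (appendOne m).blocks.reverse z +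
          ε ^ ((succLast m).length + 1) * jIndex (succLast m) *
            genFun (succLast m).blocks.reverse z))
      Metric.isOpen_ball (convex_ball _ _).isPreconnected (by simp) (fun z hz => ?_)
      (fun z hz h0 => ?_) ?_ (by simpa using hz)
    · have hz1 : ‖z‖ < 1 := mem_ball_zero_iff.mp hz
      have := fun l => differentiableAt_genFun l hz1
      fun_prop
    · have hz1 : ‖z‖ < 1 := mem_ball_zero_iff.mp hz
      have h1 := one_sub_ne_zero_of_norm_lt hz1
      have hf : ∀ k : ℕ, HasDerivAt (genFun [k + 1])
          (match k with | 0 => 1 / (1 - z) | k + 1 => genFun [k + 1] z / z) z := fun k => by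
        cases k with
        | zero => simpa [genFun_nil] using hasDerivAt_genFun_one [] hz1
        | succ k => exact hasDerivAt_genFun_succ (k + 1) [] hz1 h0
      have hg : ∀ k : ℕ, HasDerivAt (genFun (List.replicate k 1))
          (match k with | 0 => 0 | k + 1 => genFun (List.replicate k 1) z / (1 - z)) z :=
          fun k => by
        cases k with
        | zero =>
          have : genFun [] = fun _ => 1 := funext genFun_nil
          simpa [this] using hasDerivAt_const z (1 : ℂ)
        | succ k => exact hasDerivAt_genFun_one (List.replicate k 1) hz1
      have hS := HasDerivAt.fun_sum (u := Finset.range (n + 1 + 1)) fun k _ =>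
        ((hf k).mul (hg (n + 1 - k))).const_mul (ε ^ (n + 1 - k))
      have hT := HasDerivAt.fun_sum (u := (Finset.univ : Finset (Composition (n + 1)))) fun m _ =>
        ((show HasDerivAt (genFun (appendOne m).blocks.reverse)
            (genFun m.blocks.reverse z / (1 - z)) z by
          simpa [appendOne] using hasDerivAt_genFun_one m.blocks.reverse hz1).const_mul
            (ε ^ ((appendOne m).length + 1) * jIndex (appendOne m))).add
        ((show HasDerivAt (genFun (succLast m).blocks.reverse)
            (genFun m.blocks.reverse z / z) z by
          obtain ⟨s, l, h⟩ := exists_reverse_blocks_eq m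
          simpa [succLast, h, incHead] using
            hasDerivAt_genFun_succ (s + 1) l hz1 h0).const_mul
            (ε ^ ((succLast m).length + 1) * jIndex (succLast m)))
      refine (hS.sub hT).deriv.trans ?_
      -- Differentiation reproduces the sum for n times 1/z + ε / (1 - z), plus one extra term from
      -- k = 0, where L_1 has derivative 1 / (1 - z).
      have hSv : ∑ k ∈ Finset.range (n + 1 + 1), ε ^ (n + 1 - k) *
          ((match k with | 0 => 1 / (1 - z) | k + 1 => genFun [k + 1] z / z) *
              genFun (List.replicate (n + 1 - k) 1) z +
            genFun [k + 1] z * (match n + 1 - k with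
              | 0 => 0
              | k + 1 => genFun (List.replicate k 1) z / (1 - z))) =
          (∑ k ∈ Finset.range (n + 1),
            ε ^ (n - k) * (genFun [k + 1] z * genFun (List.replicate (n - k) 1) z)) *
            (z⁻¹ + ε * (1 - z)⁻¹) +
          ε ^ (n + 1) * genFun (List.replicate (n + 1) 1) z / (1 - z) := by
        simp_rw [mul_add, Finset.sum_add_distrib]
        rw [Finset.sum_range_succ', Finset.sum_range_succ (n := n + 1)]
        have h3 : ∀ k ∈ Finset.range (n + 1), ε ^ (n + 1 - k) * (genFun [k + 1] z *
            (match n + 1 - k with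
              | 0 => 0
              | k + 1 => genFun (List.replicate k 1) z / (1 - z))) =
            ε ^ (n - k) * (genFun [k + 1] z * genFun (List.replicate (n - k) 1) z) *
              (ε * (1 - z)⁻¹) := by
          intro k hk
          have : n + 1 - k = (n - k) + 1 := by
            have := Finset.mem_range.mp hk
            omega
          rw [this]
          simp only [pow_succ]
          ring
        rw [Finset.sum_congr rfl h3, ← Finset.sum_mul, Finset.sum_mul _ _ z⁻¹]
        simp only [Nat.add_sub_add_right, Nat.sub_self, Nat.sub_zero, mul_zero, add_zero]
        rw [add_right_comm]
        congr 1
        · congr 1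
          exact Finset.sum_congr rfl fun k _ => by ring
        · ring
      -- The same recursion: the extra term arises because appending a 1 raises the index only for
      -- the all-ones composition.
      have hTv : ∑ m : Composition (n + 1),
          (ε ^ ((appendOne m).length + 1) * jIndex (appendOne m) *
              (genFun m.blocks.reverse z / (1 - z)) +
            ε ^ ((succLast m).length + 1) * jIndex (succLast m) *
              (genFun m.blocks.reverse z / z)) =
          (∑ m : Composition (n + 1),
            ε ^ (m.length + 1) * jIndex m * genFun m.blocks.reverse z) *
            (z⁻¹ + ε * (1 - z)⁻¹) +
          ε ^ (n + 1) * genFun (List.replicate (n + 1) 1) z / (1 - z) := by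
        have h4 : ∀ m : Composition (n + 1),
            ε ^ ((appendOne m).length + 1) * jIndex (appendOne m) *
              (genFun m.blocks.reverse z / (1 - z)) +
            ε ^ ((succLast m).length + 1) * jIndex (succLast m) *
              (genFun m.blocks.reverse z / z) =
            ε ^ (m.length + 1) * jIndex m * genFun m.blocks.reverse z *
              (z⁻¹ + ε * (1 - z)⁻¹) +
            if m = Composition.ones (n + 1) then
              ε ^ (n + 1) * genFun (List.replicate (n + 1) 1) z / (1 - z) else 0 := by
          intro m
          have hl1 : (appendOne m).length = m.length + 1 := by
            simp [Composition.length, appendOne]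
          have hl2 : (succLast m).length = m.length := by
            obtain ⟨s, l, h⟩ := exists_reverse_blocks_eq m
            have := congrArg List.length h
            simp only [List.length_reverse, List.length_cons] at this
            simp [Composition.length, succLast, h, incHead, this]
          rw [hl1, hl2, jIndex_appendOne, jIndex_succLast]
          split_ifs with hm
          · subst hm
            have hb : (Composition.ones (n + 1)).blocks = List.replicate (n + 1) 1 := rfl
            rw [Composition.ones_length, hb, List.reverse_replicate]
            have : ε ^ (n + 1 + 1 + 1) = ε ^ (n + 1) := by
              rw [show n + 1 + 1 + 1 = (n + 1) + 2 by ring, pow_add, hε, mul_one]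
            push_cast
            rw [show ε ^ (n + 1 + 1) * ((jIndex (Composition.ones (n + 1)) : ℕ) : ℂ) *
              genFun (List.replicate (n + 1) 1) z * (z⁻¹ + ε * (1 - z)⁻¹) =
              ε ^ (n + 1 + 1) * ((jIndex (Composition.ones (n + 1)) : ℕ) : ℂ) *
              genFun (List.replicate (n + 1) 1) z * z⁻¹ + ε ^ (n + 1 + 1 + 1) *
              ((jIndex (Composition.ones (n + 1)) : ℕ) : ℂ) *
              genFun (List.replicate (n + 1) 1) z * (1 - z)⁻¹ by ring, this]
            ring
          · push_cast
            ring
        rw [Finset.sum_congr rfl fun m _ => h4 m, Finset.sum_add_distrib, ← Finset.sum_mul]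
        simp
      rw [hSv, hTv, ih hz1, sub_self]
    · have h1 : ∀ m : Composition (n + 1), (succLast m).blocks.reverse ≠ [] := fun m => by
        obtain ⟨s, l, h⟩ := exists_reverse_blocks_eq m
        simp [succLast, h, incHead]
      have h2 : ∀ m : Composition (n + 1), (appendOne m).blocks.reverse ≠ [] := fun m => by
        simp [appendOne]
      simp [genFun_zero, h1, h2]

/-! ### The coefficients -/

/-- The composition `(1, …, 1, 2)`. -/
def onesTwo (n : ℕ) : Composition (n + 2) where
  blocks := List.replicate n 1 ++ [2]
  blocks_pos := fun {i} hi => by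
    rcases List.mem_append.mp hi with h | h
    · rw [List.eq_of_mem_replicate h]; exact one_pos
    · simp at h; omega
  blocks_sum := by simp

lemma jIndex_onesTwo (n : ℕ) : jIndex (onesTwo n) = n + 1 := by
  have h : (List.replicate n 1).findIdx (fun t => decide (2 ≤ t)) = n := by
    have := List.findIdx_eq_length (p := fun t => decide (2 ≤ t)) (xs := List.replicate n 1)
    rw [List.length_replicate] at this
    exact this.mpr fun t ht => by simp [List.eq_of_mem_replicate ht]
  simp [jIndex_eq_min, onesTwo, List.findIdx_append, h]

lemma onesTwo_ne_ones (n : ℕ) : onesTwo n ≠ Composition.ones (n + 2) := fun h => by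
  have := congrArg Composition.length h
  simp [Composition.length, onesTwo, Composition.ones] at this

lemma jIndex_ones (n : ℕ) : jIndex (Composition.ones n) = n := by
  simp [jIndex, Composition.ones]

/-- The all-ones case fits the general rule; the correction at (1, …, 1, 2) is the last summand of
`zeta_eq_sum_genFun`. -/
lemma bCoeff_eq {n : ℕ} (m : Composition (n + 2)) :
    bCoeff m = jIndex m + if m = onesTwo n then 1 else 0 := by
  have h1 : m.blocks = List.replicate (n + 2) 1 ↔ m = Composition.ones (n + 2) :=
    (Composition.ext_iff (x := m) (y := Composition.ones (n + 2))).symm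
  have h2 : m.blocks = List.replicate (n + 2 - 2) 1 ++ [2] ↔ m = onesTwo n :=
    (Composition.ext_iff (x := m) (y := onesTwo n)).symm
  rw [bCoeff]
  simp only [h1, h2]
  split_ifs with h h' h'
  · exact absurd (h'.symm.trans h) (onesTwo_ne_ones n)
  · simp [h, jIndex_ones]
  · rw [h', jIndex_onesTwo]; push_cast; ring
  · simp

/-- The two corrections are the two terms of `landen_two`, with its sign. -/
lemma bPMCoeff_eq {n : ℕ} (m : Composition (n + 2)) :
    bPMCoeff m = (-1) ^ (m.length + 1) * jIndex m + (-1) ^ (n + 1) *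
      ((if m = onesTwo n then 1 else 0) + if m = Composition.ones (n + 2) then 1 else 0) := by
  have h1 : m.blocks = List.replicate (n + 2) 1 ↔ m = Composition.ones (n + 2) :=
    (Composition.ext_iff (x := m) (y := Composition.ones (n + 2))).symm
  have h2 : m.blocks = List.replicate (n + 2 - 2) 1 ++ [2] ↔ m = onesTwo n :=
    (Composition.ext_iff (x := m) (y := onesTwo n)).symm
  rw [bPMCoeff]
  simp only [h1, h2]
  split_ifs with h h' h'
  · exact absurd (h'.symm.trans h) (onesTwo_ne_ones n)
  · rw [h, jIndex_ones, Composition.ones_length]; push_cast; ring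
  · have hl : m.length = n + 1 := by simp [h', Composition.length, onesTwo]
    rw [hl, h', jIndex_onesTwo]; push_cast; ring
  · simp

/-! ### Passage to the boundary -/

/-- The boundary value at `u` of the polylogarithm with reversed exponent list `l`. -/
noncomputable def boundaryValue (l : List ℕ) (u : ℂ) : ℂ :=
  extendFrom (Metric.ball 0 1) (genFun l) u

lemma tendsto_boundaryValue {u : ℂ} (h0 : ‖u‖ = 1) (h1 : ‖1 - u‖ = 1) {l : List ℕ}
    (hl : ∀ s ∈ l, 0 < s) :
    Tendsto (genFun l) (𝓝[Metric.ball 0 1] u) (𝓝 (boundaryValue l u)) :=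
  tendsto_extendFrom (exists_tendsto_genFun h0 h1 hl)

lemma nhdsWithin_landenDomain_neBot {u : ℂ} (h0 : ‖u‖ = 1) (hre : u.re = 1 / 2) :
    (𝓝[landenDomain] u).NeBot := by
  rw [← mem_closure_iff_nhdsWithin_neBot]
  -- Radial approach: the real part t / 2 stays below 1/2.
  have ht : Tendsto (fun t : ℝ => (t : ℂ) * u) (𝓝[<] 1) (𝓝 u) := by
    have : Tendsto (fun t : ℝ => (t : ℂ) * u) (𝓝 1) (𝓝 (((1 : ℝ) : ℂ) * u)) := by
      apply Continuous.tendsto; fun_prop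
    simpa using this.mono_left nhdsWithin_le_nhds
  refine mem_closure_of_tendsto ht ?_
  filter_upwards [Ioo_mem_nhdsLT (zero_lt_one' ℝ)] with t ht
  constructor
  · rw [mem_ball_zero_iff, norm_mul, h0, mul_one, Complex.norm_real, Real.norm_of_nonneg ht.1.le]
    exact ht.2
  · simp only [Set.mem_ofPred_eq, Complex.re_ofReal_mul, hre]
    linarith [ht.2]

lemma nhdsWithin_ball_neBot {u : ℂ} (h0 : ‖u‖ = 1) (hre : u.re = 1 / 2) :
    (𝓝[Metric.ball 0 1] u).NeBot :=
  (nhdsWithin_landenDomain_neBot h0 hre).mono (nhdsWithin_mono _ Set.inter_subset_left)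

lemma nhdsWithin_ball_inter_ball_neBot {u : ℂ} (h0 : ‖u‖ = 1) (h1 : ‖1 - u‖ = 1) :
    (𝓝[Metric.ball 0 1 ∩ Metric.ball 1 1] u).NeBot := by
  rw [← mem_closure_iff_nhdsWithin_neBot]
  -- Approach along the segment towards 1/2; this segment is mapped by z ↦ 1 - z to the one from 1 -
  -- u, so a single estimate serves both discs.
  have ht : Tendsto (fun t : ℝ => ((1 - t : ℝ) : ℂ) * u + ((t / 2 : ℝ) : ℂ)) (𝓝[>] 0) (𝓝 u) := by
    have : Tendsto (fun t : ℝ => ((1 - t : ℝ) : ℂ) * u + ((t / 2 : ℝ) : ℂ)) (𝓝 0)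
        (𝓝 (((1 - 0 : ℝ) : ℂ) * u + ((0 / 2 : ℝ) : ℂ))) := by
      apply Continuous.tendsto; fun_prop
    simpa using this.mono_left nhdsWithin_le_nhds
  refine mem_closure_of_tendsto ht ?_
  filter_upwards [Ioo_mem_nhdsGT (zero_lt_one' ℝ)] with t ht
  have key : ∀ v : ℂ, ‖v‖ = 1 → ‖((1 - t : ℝ) : ℂ) * v + ((t / 2 : ℝ) : ℂ)‖ < 1 := fun v hv => by
    refine (norm_add_le _ _).trans_lt ?_
    rw [norm_mul, hv, Complex.norm_real, Complex.norm_real,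
      Real.norm_of_nonneg (by linarith [ht.2]), Real.norm_of_nonneg (by linarith [ht.1])]
    linarith [ht.1]
  constructor
  · rw [mem_ball_zero_iff]; exact key u h0
  · rw [mem_ball_iff_norm']
    have h := key (1 - u) h1
    rwa [show ((1 - t : ℝ) : ℂ) * (1 - u) + ((t / 2 : ℝ) : ℂ) =
      1 - (((1 - t : ℝ) : ℂ) * u + ((t / 2 : ℝ) : ℂ)) by push_cast; ring] at h

lemma polylog_eq_boundaryValue {r : ℕ} (m : Composition r) {u : ℂ} (h0 : ‖u‖ = 1)
    (h1 : ‖1 - u‖ = 1) (hre : u.re = 1 / 2) :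
    polylog m.blocksFun u = boundaryValue m.blocks.reverse u := by
  have := nhdsWithin_ball_neBot h0 hre
  exact tendsto_nhds_unique (tendsto_genFun_polylog m h0 h1)
    (tendsto_boundaryValue h0 h1 fun s hs => m.blocks_pos (by simpa using hs))

lemma pos_of_mem_replicate_one {n s : ℕ} (h : s ∈ List.replicate n 1) : 0 < s := by
  rw [List.eq_of_mem_replicate h]; exact one_pos

lemma pos_of_mem_two_cons {n s : ℕ} (h : s ∈ 2 :: List.replicate n 1) : 0 < s := by
  rcases List.mem_cons.mp h with rfl | h
  · exact two_pos
  · exact pos_of_mem_replicate_one h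

lemma zeta_eq_sum_boundaryValue {u : ℂ} (h0 : ‖u‖ = 1) (h1 : ‖1 - u‖ = 1)
    (n : ℕ) :
    riemannZeta (n + 2 : ℕ) = ∑ k ∈ Finset.range (n + 2),
      boundaryValue [k + 1] u * boundaryValue (List.replicate (n + 1 - k) 1) (1 - u)
      + boundaryValue (2 :: List.replicate n 1) (1 - u) := by
  have := nhdsWithin_ball_inter_ball_neBot h0 h1
  have h1' : ‖1 - (1 - u)‖ = 1 := by rwa [sub_sub_cancel]
  have hid : Tendsto id (𝓝[Metric.ball 0 1 ∩ Metric.ball 1 1] u) (𝓝[Metric.ball 0 1] u) :=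
    tendsto_id.mono_left (nhdsWithin_mono _ Set.inter_subset_left)
  have hsub : Tendsto (fun z : ℂ => 1 - z) (𝓝[Metric.ball 0 1 ∩ Metric.ball 1 1] u)
      (𝓝[Metric.ball 0 1] (1 - u)) := by
    refine tendsto_nhdsWithin_iff.mpr ⟨?_, ?_⟩
    · exact ((continuous_const.sub continuous_id).tendsto u).mono_left nhdsWithin_le_nhds
    · filter_upwards [self_mem_nhdsWithin] with z hz
      rw [mem_ball_zero_iff, ← mem_ball_iff_norm']
      exact hz.2
  refine tendsto_nhds_unique (tendsto_const_nhds.congr' ?_)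
    ((tendsto_finsetSum (Finset.range (n + 2)) fun k _ =>
      ((tendsto_boundaryValue h0 h1 (l := [k + 1]) (by simp)).comp hid).mul
      ((tendsto_boundaryValue h1 h1' (l := List.replicate (n + 1 - k) 1)
        fun _ => pos_of_mem_replicate_one).comp hsub)).add
      ((tendsto_boundaryValue h1 h1' (l := 2 :: List.replicate n 1)
        fun _ => pos_of_mem_two_cons).comp hsub))
  filter_upwards [self_mem_nhdsWithin] with z hz
  exact zeta_eq_sum_genFun n (mem_ball_zero_iff.mp hz.1) (mem_ball_iff_norm'.mp hz.2)

lemma sum_boundaryValue_mul_ones {u : ℂ} (h0 : ‖u‖ = 1) (h1 : ‖1 - u‖ = 1)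
    (hre : u.re = 1 / 2) {ε : ℂ} (hε : ε ^ 2 = 1) (n : ℕ) :
    ∑ k ∈ Finset.range (n + 1),
      ε ^ (n - k) * (boundaryValue [k + 1] u * boundaryValue (List.replicate (n - k) 1) u) =
    ∑ m : Composition (n + 1), ε ^ (m.length + 1) * jIndex m * polylog m.blocksFun u := by
  have := nhdsWithin_ball_neBot h0 hre
  refine tendsto_nhds_unique
    (tendsto_finsetSum (Finset.range (n + 1)) fun k _ =>
      ((tendsto_boundaryValue h0 h1 (l := [k + 1]) (by simp)).mul
      (tendsto_boundaryValue h0 h1 (l := List.replicate (n - k) 1)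
        fun _ => pos_of_mem_replicate_one)).const_mul (ε ^ (n - k)))
    (Tendsto.congr' ?_ (tendsto_finsetSum (Finset.univ : Finset (Composition (n + 1))) fun m _ =>
      (tendsto_genFun_polylog m h0 h1).const_mul (ε ^ (m.length + 1) * jIndex m)))
  filter_upwards [self_mem_nhdsWithin] with z hz
  exact (sum_genFun_mul_genFun_ones hε n (mem_ball_zero_iff.mp hz)).symm

lemma tendsto_div_sub_one {u : ℂ} (h1 : ‖1 - u‖ = 1)
    (hu : u / (u - 1) = 1 - u) :
    Tendsto (fun z : ℂ => z / (z - 1)) (𝓝[landenDomain] u) (𝓝[Metric.ball 0 1] (1 - u)) := by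
  have hne : u - 1 ≠ 0 := by
    rw [← neg_sub, neg_ne_zero]; rintro h; simp [h] at h1
  refine tendsto_nhdsWithin_iff.mpr ⟨?_, ?_⟩
  · rw [← hu]
    exact ((hasDerivAt_div_sub_one hne).continuousAt.tendsto).mono_left nhdsWithin_le_nhds
  · filter_upwards [self_mem_nhdsWithin] with z hz
    rw [mem_ball_zero_iff]
    exact norm_div_sub_one_lt (mem_ball_zero_iff.mp hz.1) hz.2

lemma boundaryValue_ones_one_sub {u : ℂ} (h0 : ‖u‖ = 1) (h1 : ‖1 - u‖ = 1)
    (hre : u.re = 1 / 2) (hu : u / (u - 1) = 1 - u) (n : ℕ) :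
    boundaryValue (List.replicate n 1) (1 - u) = (-1) ^ n * boundaryValue (List.replicate n 1) u := by
  have := nhdsWithin_landenDomain_neBot h0 hre
  have h1' : ‖1 - (1 - u)‖ = 1 := by rwa [sub_sub_cancel]
  refine tendsto_nhds_unique ((tendsto_boundaryValue h1 h1'
    fun _ => pos_of_mem_replicate_one).comp (tendsto_div_sub_one h1 hu))
    (Tendsto.congr' ?_ (((tendsto_boundaryValue h0 h1 fun _ => pos_of_mem_replicate_one).mono_left
      (nhdsWithin_mono _ Set.inter_subset_left)).const_mul ((-1) ^ n)))
  filter_upwards [self_mem_nhdsWithin] with z hz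
  exact (landen_ones n hz).symm

lemma boundaryValue_two_one_sub {u : ℂ} (h0 : ‖u‖ = 1) (h1 : ‖1 - u‖ = 1)
    (hre : u.re = 1 / 2) (hu : u / (u - 1) = 1 - u) (n : ℕ) :
    boundaryValue (2 :: List.replicate n 1) (1 - u) = (-1) ^ (n + 1) *
      (boundaryValue (2 :: List.replicate n 1) u + boundaryValue (List.replicate (n + 2) 1) u) := by
  have := nhdsWithin_landenDomain_neBot h0 hre
  have h1' : ‖1 - (1 - u)‖ = 1 := by rwa [sub_sub_cancel]
  refine tendsto_nhds_unique ((tendsto_boundaryValue h1 h1'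
    fun _ => pos_of_mem_two_cons).comp (tendsto_div_sub_one h1 hu))
    (Tendsto.congr' ?_ ((((tendsto_boundaryValue h0 h1 fun _ => pos_of_mem_two_cons).add
      (tendsto_boundaryValue h0 h1 fun _ => pos_of_mem_replicate_one)).mono_left
      (nhdsWithin_mono _ Set.inter_subset_left)).const_mul ((-1) ^ (n + 1))))
  filter_upwards [self_mem_nhdsWithin] with z hz
  exact (landen_two n hz).symm

/-! ### The formulas at ρ^(±1) and 1/2 -/

/-- Landen's transformation replaces the all-ones factor at 1 - u by (-1) ^ (n + 1 - k) times its
value at u, which is the shuffle expansion with ε = -1. -/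
lemma zeta_eq_sum_bPMCoeff {u : ℂ} (h0 : ‖u‖ = 1) (h1 : ‖1 - u‖ = 1)
    (hre : u.re = 1 / 2) (hu : u / (u - 1) = 1 - u) (n : ℕ) :
    riemannZeta (n + 2 : ℕ) =
      ∑ m : Composition (n + 2), (bPMCoeff m : ℂ) * polylog m.blocksFun u := by
  have hsum := sum_boundaryValue_mul_ones h0 h1 hre (ε := -1) (by norm_num) (n + 1)
  have htwo : polylog (onesTwo n).blocksFun u = boundaryValue (2 :: List.replicate n 1) u := by
    rw [polylog_eq_boundaryValue _ h0 h1 hre]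
    simp [onesTwo]
  have hone : polylog (Composition.ones (n + 2)).blocksFun u =
      boundaryValue (List.replicate (n + 2) 1) u := by
    rw [polylog_eq_boundaryValue _ h0 h1 hre]
    simp [Composition.ones]
  rw [zeta_eq_sum_boundaryValue h0 h1, boundaryValue_two_one_sub h0 h1 hre hu, ← htwo, ← hone]
  simp_rw [boundaryValue_ones_one_sub h0 h1 hre hu, bPMCoeff_eq]
  push_cast
  simp_rw [add_mul, Finset.sum_add_distrib]
  rw [← hsum]
  congr 1
  · exact Finset.sum_congr rfl fun k _ => by ring
  · simp [mul_assoc, ← Finset.mul_sum, add_mul, Finset.sum_add_distrib]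

lemma zeta_eq_sum_bCoeff (n : ℕ) :
    riemannZeta (n + 2 : ℕ) =
      ∑ m : Composition (n + 2), (bCoeff m : ℂ) * polylog m.blocksFun (1 / 2) := by
  have hz : ‖(1 / 2 : ℂ)‖ < 1 := by norm_num
  have hh : (1 - 1 / 2 : ℂ) = 1 / 2 := by norm_num
  have hsum := sum_genFun_mul_genFun_ones (ε := 1) (by norm_num) (n + 1) hz
  have htwo : polylog (onesTwo n).blocksFun (1 / 2) =
      genFun (2 :: List.replicate n 1) (1 / 2) := by
    rw [polylog_eq_genFun _ hz]
    simp [onesTwo]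
  rw [zeta_eq_sum_genFun n hz (by rwa [hh]), hh, ← htwo]
  simp_rw [bCoeff_eq]
  push_cast
  simp_rw [add_mul, Finset.sum_add_distrib]
  simp only [one_pow, one_mul] at hsum
  rw [hsum]
  congr 1
  · exact Finset.sum_congr rfl fun m _ => by rw [polylog_eq_genFun _ hz]
  · simp

/-! ### Arithmetic of ρ -/

lemma rho_eq : rho = 1 / 2 + (Real.sqrt 3 / 2 : ℝ) * Complex.I := by
  have : rho = Complex.exp ((Real.pi / 3 : ℝ) * Complex.I) := by
    rw [rho]; congr 1; push_cast; ring
  rw [this, Complex.exp_mul_I, ← Complex.ofReal_cos, ← Complex.ofReal_sin, Real.cos_pi_div_three,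
    Real.sin_pi_div_three]
  push_cast; ring

lemma rho_sq : rho ^ 2 = rho - 1 := by
  have h3 : ((Real.sqrt 3 : ℝ) : ℂ) ^ 2 = 3 := by
    rw [← Complex.ofReal_pow, Real.sq_sqrt (by norm_num)]; norm_num
  rw [rho_eq]
  push_cast
  ring_nf
  rw [h3, Complex.I_sq]
  ring

lemma norm_rho : ‖rho‖ = 1 := by
  have : rho = Complex.exp ((Real.pi / 3 : ℝ) * Complex.I) := by
    rw [rho]; congr 1; push_cast; ring
  rw [this, Complex.norm_exp_ofReal_mul_I]

lemma rho_inv : rho⁻¹ = 1 - rho := by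
  rw [inv_eq_iff_eq_inv]
  refine eq_inv_of_mul_eq_one_left ?_
  linear_combination -rho_sq

lemma re_rho : rho.re = 1 / 2 := by simp [rho_eq]

/-- The primitive sixth roots of unity are the points where z ↦ 1 - z and Landen's map agree. -/
lemma div_sub_one_eq_one_sub {u : ℂ} (hu : u ^ 2 = u - 1) : u / (u - 1) = 1 - u := by
  have hne : u - 1 ≠ 0 := fun h => by
    rw [h] at hu
    have : u = 0 := by simpa using hu
    simp [this] at h
  rw [div_eq_iff hne]
  linear_combination hu

end Polyzeta

theorem theorem10 (r : ℕ) (hr : 2 ≤ r) :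
    (∀ m : Composition r, ∀ z : ℂ, ‖z‖ < 1 →
      Summable (Polyzeta.polylogTerm m.blocksFun z)) ∧
    (∀ m : Composition r, ∀ z : ℂ, z = Polyzeta.rho ∨ z = Polyzeta.rho⁻¹ →
      Filter.Tendsto (Polyzeta.polylogSeries m.blocksFun)
        (nhdsWithin z (Metric.ball (0 : ℂ) 1)) (nhds (Polyzeta.polylog m.blocksFun z))) ∧
    riemannZeta (r : ℂ) =
      ∑ m : Composition r,
        (Polyzeta.bCoeff m : ℂ) * Polyzeta.polylog m.blocksFun (1 / 2) ∧
    riemannZeta (r : ℂ) =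
      ∑ m : Composition r,
        (Polyzeta.bPMCoeff m : ℂ) * Polyzeta.polylog m.blocksFun Polyzeta.rho ∧
    riemannZeta (r : ℂ) =
      ∑ m : Composition r,
        (Polyzeta.bPMCoeff m : ℂ) * Polyzeta.polylog m.blocksFun Polyzeta.rho⁻¹ := by
  open Polyzeta in
  obtain ⟨n, rfl⟩ : ∃ n, r = n + 2 := ⟨r - 2, by omega⟩
  have h0 := norm_rho
  have h0' : ‖rho⁻¹‖ = 1 := by rw [norm_inv, h0, inv_one]
  have h1 : ‖1 - rho‖ = 1 := by rwa [← rho_inv]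
  have h1' : ‖1 - rho⁻¹‖ = 1 := by rwa [rho_inv, sub_sub_cancel]
  have hsq' : rho⁻¹ ^ 2 = rho⁻¹ - 1 := by rw [rho_inv]; linear_combination rho_sq
  have hre' : rho⁻¹.re = 1 / 2 := by
    rw [rho_inv, Complex.sub_re, re_rho, Complex.one_re]; norm_num
  refine ⟨fun m z hz => (summable_norm_polylogTerm _ hz).of_norm, ?_, zeta_eq_sum_bCoeff n,
    zeta_eq_sum_bPMCoeff h0 h1 re_rho (div_sub_one_eq_one_sub rho_sq) n,
    zeta_eq_sum_bPMCoeff h0' h1' hre' (div_sub_one_eq_one_sub hsq') n⟩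
  rintro m z (rfl | rfl)
  · exact tendsto_polylogSeries m h0 h1
  · exact tendsto_polylogSeries m h0' h1'
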